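/- A transmitter with $M\ge 1$ antennas and transmit power $P>0$ powers finitely many devices $s_i$ with average channel gains $\beta_i>0$; let $s_{i'}$ be a device with the smallest gain. In coherence blocks of length $T_c>0$, the downlink fading coefficients of each device are independent across antennas and blocks, each with law $\mathcal{CN}\big(\sqrt{\kappa/(1+\kappa)},\,1/(1+\kappa)\big)$, $\kappa\ge 0$. Under the switching-antenna (SA) scheme, in every block each antenna in turn transmits alone with full power $P$ for $T_c/M$ seconds, so that a device with gain $\beta_i$ and block fading vector $\mathbf h$ harvests $\eta T_c E_i^{\rm rf}$ in the block, where $E_i^{\rm rf}=\frac{P\beta_i}{M}\|\mathbf h\|^2$ and $\eta\in(0,1)$. Let $p_c,p,t,\xi_{\rm csi}^{(u)}\ge 0$ be the circuit power, the transmit power, the message duration and the uplink-CSI energy (the same for all devices). No downlink CSI is acquired under SA. Let $\mathcal O_i^{(d)}$ be the energy outage probability of $s_i$, that is, the probability that the energy harvested between its transmissions is smaller than the energy required. Denote by $\mathcal Q_m(a,b)=\int_b^\infty x\,(x/a)^{m-1}e^{-(x^2+a^2)/2}I_{m-1}(ax)\,dx$ the Marcum Q-function (extended to $a=0$ by continuity).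 For $\xi\ge 0$, $\Pi>0$ and an integer $N\ge 1$ put $$F_{\rm per}(\xi,\Pi,N)=1-\mathcal Q_{Nn}\Big(\sqrt{2N\kappa n},\ \sqrt{\tfrac{2E_0(\kappa+1)}{\eta T_c\Pi\beta_{i'}}}\Big),\qquad n=\lceil t_s/T_c\rceil,\quad E_0=n\xi+\xi_{\rm csi}^{(u)}+p_ct_s+pt,$$ $$F_{\rm Poi}(\xi,\Pi,N;v_{\max})=1-(e^\lambda-1)\sum_{v=1}^{v_{\max}}e^{-\lambda v}\,\mathcal Q_{Nv}\Big(\sqrt{2N\kappa v},\ \sqrt{\tfrac{2(1+\kappa)}{\eta T_c\Pi\beta_{i'}}}\,\sqrt{v(\xi+p_cT_c)+\xi_{\rm csi}^{(u)}+pt}\Big).$$ (i) Periodic traffic with period $t_s>0$: the energy is harvested over $n=\lceil t_s/T_c\rceil$ blocks and the requirement is $\xi_{\rm csi}^{(u)}+p_ct_s+pt$. Then, exactly, $$\sup_i\mathcal O_i^{(d)}=\mathcal O_{i'}^{(d)}=F_{\rm per}(0,P/M,M).$$ (ii) Poisson traffic with rate $\lambda>0$ per coherence interval: for each device an exponential inter-arrival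 time $U$ with mean $1/\lambda$, independent of its fading, is rounded to the integer $V\ge 1$ with $V-1\le U<V$; the energy is harvested over $V$ blocks and the requirement is $\xi_{\rm csi}^{(u)}+p_cVT_c+pt$. Then $\sup_i\mathcal O_i^{(d)}=\mathcal O_{i'}^{(d)}$, and $F_{\rm Poi}(0,P/M,M;v_{\max})$ approximates it: for every $v_{\max}\ge 0$, $$\mathcal O_{i'}^{(d)}\ \le\ F_{\rm Poi}(0,P/M,M;v_{\max})\ \le\ \mathcal O_{i'}^{(d)}+e^{-\lambda v_{\max}};$$ in particular the error is at most $e^{-10}$ whenever $v_{\max}\ge 10\,\frac{e^\lambda}{e^\lambda-1}$, and it tends to $0$ as $v_{\max}\to\infty$. -/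

import Mathlib

open MeasureTheory ProbabilityTheory Filter Topology
open scoped NNReal ENNReal Nat

namespace SAOutage

noncomputable section

/-! ### Special functions -/

/-- The modified Bessel function of the first kind `I_n` of integer order `n ≥ 0`. -/
def besselI (n : ℕ) (z : ℝ) : ℝ :=
  ∑' k : ℕ, (z / 2) ^ (2 * k + n) / ((k ! : ℝ) * ((k + n)! : ℝ))

/-- The integrand of the Marcum Q-function of order `m ≥ 1`. For `a ≠ 0` it is
`x (x/a)^(m-1) exp(-(x²+a²)/2) I_{m-1}(a x)`; for `a = 0` it is the limit of this as `a → 0`. -/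
def marcumKernel (m : ℕ) (a x : ℝ) : ℝ :=
  if a = 0 then
    x ^ (2 * m - 1) * Real.exp (-x ^ 2 / 2) / (2 ^ (m - 1) * ((m - 1)! : ℝ))
  else
    x * (x / a) ^ (m - 1) * Real.exp (-(x ^ 2 + a ^ 2) / 2) * besselI (m - 1) (a * x)

/-- The (generalized) Marcum Q-function `Q_m(a, b)`, for `m ≥ 1` and `a, b ≥ 0`. -/
def marcumQ (m : ℕ) (a b : ℝ) : ℝ :=
  ∫ x in Set.Ioi b, marcumKernel m a x

/-! ### Channel and energy transfer -/

/-- The circularly-symmetric complex Gaussian law `CN(c, v)`: independent real and imaginary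
parts, each of variance `v / 2`, with mean `c`. -/
def complexGaussian (c : ℂ) (v : ℝ≥0) : Measure ℂ :=
  ((gaussianReal c.re (v / 2)).prod (gaussianReal c.im (v / 2))).map
    (fun z : ℝ × ℝ => (⟨z.1, z.2⟩ : ℂ))

/-- The law of one Rician fading coefficient with Rician factor `κ`:
`CN(√(κ / (1 + κ)), 1 / (1 + κ))`. -/
def ricianLaw (κ : ℝ) : Measure ℂ :=
  complexGaussian ((Real.sqrt (κ / (1 + κ)) : ℝ) : ℂ) (Real.toNNReal (1 / (1 + κ)))

/-- `h b a` is the downlink fading coefficient of antenna `a` during coherence block `b`: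
all coefficients have the Rician law and are independent across antennas and blocks. -/
structure IsRicianChannel {Ω : Type*} [MeasurableSpace Ω] (μ : Measure Ω) (κ : ℝ) {M : ℕ}
    (h : ℕ → Fin M → Ω → ℂ) : Prop where
  hasLaw : ∀ b a, HasLaw (h b a) (ricianLaw κ) μ
  indep : iIndepFun (fun ba : ℕ × Fin M => h ba.1 ba.2) μ

/-- The RF power incident at a device with average channel gain `β` and fading vector `h`, when
the transmitter uses total power `P` and the precoding vectors `w j` for unit-power,
uncorrelated signals: `P β ∑ⱼ |hᵀ wⱼ|²`. -/
def incidentPower {M : ℕ} {J : Type*} [Fintype J] (P β : ℝ) (h : Fin M → ℂ)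
    (w : J → Fin M → ℂ) : ℝ :=
  P * β * ∑ j, ‖h ⬝ᵥ w j‖ ^ 2

/-- The RF energy incident at a device during one coherence block of length `Tc` under the
switching-antenna scheme: each of the `M` antennas in turn transmits alone, with full power `P`,
for `Tc / M` seconds. -/
def saBlockEnergy {M : ℕ} (P β Tc : ℝ) (h : Fin M → ℂ) : ℝ :=
  ∑ a : Fin M, (Tc / M) * incidentPower P β h (fun _ : Unit => (Pi.single a 1 : Fin M → ℂ))

/-- The energy harvested under the switching-antenna scheme during `n` coherence blocks by a
linear harvester with conversion efficiency `η`. -/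
def saHarvested {M : ℕ} (η P β Tc : ℝ) (n : ℕ) (h : ℕ → Fin M → ℂ) : ℝ :=
  η * ∑ b ∈ Finset.range n, saBlockEnergy P β Tc (h b)

/-! ### Energy requirements -/

/-- The number of coherence blocks in one period under periodic traffic, `⌈t_s / T_c⌉`. -/
def periodBlocks (ts Tc : ℝ) : ℕ := ⌈ts / Tc⌉₊

/-- The energy required per period under periodic traffic: downlink CSI in each block, uplink
CSI, circuit consumption, and transmission of the message. -/
def periodicRequirement (ξd ξu pc p t ts Tc : ℝ) : ℝ :=
  (periodBlocks ts Tc : ℝ) * ξd + ξu + pc * ts + p * t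

/-- The energy required between transmissions that are `v` coherence blocks apart. -/
def poissonRequirement (ξd ξu pc p t Tc : ℝ) (v : ℕ) : ℝ :=
  v * ξd + ξu + pc * v * Tc + p * t

/-- The slotted inter-arrival time, in coherence blocks: `V = v` iff `v - 1 ≤ U < v`
(for `U ≥ 0`). -/
def slotted (u : ℝ) : ℕ := ⌊u⌋₊ + 1

/-! ### Energy outage probabilities under the switching-antenna scheme -/

/-- The energy outage probability under periodic traffic (no downlink CSI is acquired). -/
def saPeriodicOutage {Ω : Type*} [MeasurableSpace Ω] (μ : Measure Ω) {M : ℕ}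
    (η P β Tc ξu pc p t ts : ℝ) (h : ℕ → Fin M → Ω → ℂ) : ℝ :=
  μ.real {ω | saHarvested η P β Tc (periodBlocks ts Tc) (fun b a => h b a ω)
    < periodicRequirement 0 ξu pc p t ts Tc}

/-- The energy outage probability under Poisson traffic with inter-arrival time `U`
(no downlink CSI is acquired). -/
def saPoissonOutage {Ω : Type*} [MeasurableSpace Ω] (μ : Measure Ω) {M : ℕ}
    (η P β Tc ξu pc p t : ℝ) (h : ℕ → Fin M → Ω → ℂ) (U : Ω → ℝ) : ℝ :=
  μ.real {ω | saHarvested η P β Tc (slotted (U ω)) (fun b a => h b a ω)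
    < poissonRequirement 0 ξu pc p t Tc (slotted (U ω))}

/-! ### The closed-form expressions, for general `ξd`, `P` and number of antennas `Mt` -/

/-- The Marcum-Q expression for periodic traffic. -/
def periodicExpr (Mt : ℕ) (ξd η P β Tc κ ξu pc p t ts : ℝ) : ℝ :=
  1 - marcumQ (Mt * periodBlocks ts Tc)
    (Real.sqrt (2 * Mt * κ * periodBlocks ts Tc))
    (Real.sqrt (2 * periodicRequirement ξd ξu pc p t ts Tc * (κ + 1) / (η * Tc * P * β)))

/-- The `v`-th summand of the mixture expression for Poisson traffic. -/
def poissonTerm (Mt : ℕ) (ξd η P β Tc κ ξu pc p t lam : ℝ) (v : ℕ) : ℝ :=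
  Real.exp (-lam * v) * marcumQ (Mt * v) (Real.sqrt (2 * Mt * κ * v))
    (Real.sqrt (2 * (1 + κ) / (η * Tc * P * β)) *
      Real.sqrt (v * (ξd + pc * Tc) + ξu + p * t))

/-- The mixture expression for Poisson traffic, truncated at `vmax`. -/
def poissonExpr (Mt : ℕ) (ξd η P β Tc κ ξu pc p t lam : ℝ) (vmax : ℕ) : ℝ :=
  1 - (Real.exp lam - 1) *
    ∑ v ∈ Finset.Icc 1 vmax, poissonTerm Mt ξd η P β Tc κ ξu pc p t lam v

end

end SAOutage

/-!
The energy harvested over `n` blocks is a positive multiple of the sum of the `M * n` independent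
squared moduli `|h b a|²`. Scaled by `2 (1 + κ)`, each is the squared modulus of a complex Gaussian
whose real and imaginary parts have unit variance. The sum therefore has moment generating function
`(1 - 2t)^(-M n) exp (κ M n (1 / (1 - 2t) - 1))` for `t < 1/2` (`mgf_channelEnergy`).

On the other side, expanding the Bessel function shows the integrand of the Marcum Q-function of
order `m` to be a Poisson mixture of central chi densities (`hasSum_marcumKernel`). So it is a
probability density on `(0, ∞)`, and the square of a variable with this density has moment
generating function `(1 - 2t)^(-m) exp (a² / 2 (1 / (1 - 2t) - 1))` (`mgf_sq_noncentralChi`). With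
`m = M n` and `a² = 2 M κ n` the two agree near `0`; by analytic continuation to the imaginary axis
the laws agree (`map_eq_map_of_mgf_eqOn_Iio`). Hence the probability that the harvested energy is
below a threshold is exactly `1 - Q` (`measureReal_saHarvested_lt`), which is the claim for periodic
traffic.

For Poisson traffic, `V` is geometric and independent of the fading, so the outage probability is
`∑ v, P(V = v) (1 - Q_v)` (`hasSum_saPoissonOutage`). Dropping the terms `P(V = v) Q_v` with
`v > vmax` increases the value by at most `P(V > vmax) = e^(-lam vmax)` (`truncation_bounds`).

In both cases the outage probability is antitone in the channel gain, because the Marcum Q-function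
is antitone in its second argument; so the device with the smallest gain attains the supremum.
-/

namespace SAOutage

noncomputable section

/-! ### Laws determined by their moment generating functions -/

/-- Two real random variables whose moment generating functions are finite and equal on a
half-line `(-∞, c)`, `c > 0`, have the same law: the complex moment generating functions are
analytic on the half-plane `re z < c`, which contains the imaginary axis. -/
lemma map_eq_map_of_mgf_eqOn_Iio {Ω Ω' : Type*} [MeasurableSpace Ω] [MeasurableSpace Ω']
    {μ : Measure Ω} {ν : Measure Ω'} [IsFiniteMeasure μ] [IsFiniteMeasure ν]
    {X : Ω → ℝ} {Y : Ω' → ℝ} (hX : AEMeasurable X μ) (hY : AEMeasurable Y ν) {c : ℝ} (hc : 0 < c)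
    (h : ∀ t < c, mgf X μ t = mgf Y ν t) (hpos : ∀ t < c, 0 < mgf X μ t) :
    μ.map X = ν.map Y := by
  have hXs : Set.Iio c ⊆ interior (integrableExpSet X μ) :=
    interior_maximal (fun t ht => by
      by_contra hn
      exact (hpos t ht).ne' (mgf_undef hn)) isOpen_Iio
  have hYs : Set.Iio c ⊆ interior (integrableExpSet Y ν) :=
    interior_maximal (fun t ht => by
      by_contra hn
      exact (hpos t ht).ne' ((h t ht).trans (mgf_undef hn))) isOpen_Iio
  have hE : Set.EqOn (complexMGF X μ) (complexMGF Y ν) {z : ℂ | z.re < c} := by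
    refine AnalyticOnNhd.eqOn_of_preconnected_of_frequently_eq
      (analyticOnNhd_complexMGF.mono fun z hz => hXs hz)
      (analyticOnNhd_complexMGF.mono fun z hz => hYs hz)
      (convex_halfSpace_re_lt c).isPreconnected (z₀ := ((0 : ℝ) : ℂ)) (by simpa using hc) ?_
    have hev : ∀ᶠ x : ℝ in 𝓝[≠] 0, complexMGF X μ x = complexMGF Y ν x := by
      filter_upwards [nhdsWithin_le_nhds (Iio_mem_nhds hc)] with x hx
      rw [complexMGF_ofReal, complexMGF_ofReal, h x hx]
    refine Tendsto.frequently (l₁ := 𝓝[≠] (0 : ℝ)) (f := fun x : ℝ => (x : ℂ))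
      (p := fun z => complexMGF X μ z = complexMGF Y ν z) ?_ hev.frequently
    refine tendsto_nhdsWithin_iff.2 ⟨?_, ?_⟩
    · exact (Complex.continuous_ofReal.tendsto 0).mono_left nhdsWithin_le_nhds
    · filter_upwards [self_mem_nhdsWithin] with x hx
      simpa using hx
  refine Measure.ext_of_charFun (funext fun t => ?_)
  rw [← complexMGF_mul_I hX, ← complexMGF_mul_I hY]
  exact hE (by simpa using hc)

/-! ### The noncentral chi distribution and the Marcum Q-function -/

/-- The density `x^(2j-1) exp(-x²/2) / (2^(j-1) (j-1)!)` of the chi distribution with `2j` degrees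
of freedom, for `j ≥ 1` and `x > 0`. -/
def chiPDF (j : ℕ) (x : ℝ) : ℝ :=
  x ^ (2 * j - 1) * Real.exp (-x ^ 2 / 2) / (2 ^ (j - 1) * ((j - 1)! : ℝ))

lemma chiPDF_nonneg (j : ℕ) {x : ℝ} (hx : 0 < x) : 0 ≤ chiPDF j x := by
  unfold chiPDF; positivity

lemma measurable_chiPDF (j : ℕ) : Measurable (chiPDF j) := by
  unfold chiPDF; fun_prop

/-- The weight at `k` of the Poisson law of mean `a² / 2`. -/
def mixtureWeight (a : ℝ) (k : ℕ) : ℝ :=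
  Real.exp (-a ^ 2 / 2) * (a ^ 2 / 2) ^ k / (k ! : ℝ)

lemma mixtureWeight_nonneg (a : ℝ) (k : ℕ) : 0 ≤ mixtureWeight a k := by
  unfold mixtureWeight; positivity

lemma hasSum_besselI (n : ℕ) (z : ℝ) :
    HasSum (fun k : ℕ => (z / 2) ^ (2 * k + n) / ((k ! : ℝ) * ((k + n)! : ℝ))) (besselI n z) := by
  refine Summable.hasSum ?_
  refine Summable.of_norm_bounded (g := fun k : ℕ => |z / 2| ^ n * (((z / 2) ^ 2) ^ k / (k ! : ℝ)))
    ((Real.summable_pow_div_factorial _).mul_left _) fun k => ?_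
  rw [Real.norm_eq_abs, abs_div, abs_pow, pow_add, pow_mul, sq_abs,
    abs_of_nonneg (by positivity : (0:ℝ) ≤ (k ! : ℝ) * ((k + n)! : ℝ)), mul_comm, mul_div_assoc]
  gcongr
  exact le_mul_of_one_le_right (by positivity) (by exact_mod_cast (k + n).factorial_pos)

/-- The Marcum kernel is a Poisson mixture of central chi densities; this covers the separately
defined kernel at `a = 0`, where only the weight at `k = 0` survives. -/
lemma hasSum_marcumKernel {m : ℕ} (hm : 1 ≤ m) (a x : ℝ) :
    HasSum (fun k => mixtureWeight a k * chiPDF (m + k) x) (marcumKernel m a x) := by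
  obtain ⟨n, rfl⟩ : ∃ n, m = n + 1 := ⟨m - 1, by omega⟩
  unfold marcumKernel
  split_ifs with ha
  · subst ha
    convert hasSum_single (f := fun k => mixtureWeight 0 k * chiPDF (n + 1 + k) x) 0 ?_ using 1
    · simp [mixtureWeight, chiPDF]
    · intro k hk
      simp [mixtureWeight, hk]
  · have key := (hasSum_besselI n (a * x)).mul_left
      (x * (x / a) ^ n * Real.exp (-(x ^ 2 + a ^ 2) / 2))
    rw [Nat.add_sub_cancel]
    refine HasSum.congr_fun key fun k => ?_
    have e : Real.exp (-(x ^ 2 + a ^ 2) / 2) = Real.exp (-a ^ 2 / 2) * Real.exp (-x ^ 2 / 2) := by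
      rw [← Real.exp_add]; ring_nf
    have h1 : n + 1 + k - 1 = k + n := by omega
    have h2 : 2 * (n + 1 + k) - 1 = 2 * n + 2 * k + 1 := by omega
    have f1 : (k ! : ℝ) ≠ 0 := by exact_mod_cast Nat.factorial_ne_zero _
    have f2 : ((k + n)! : ℝ) ≠ 0 := by exact_mod_cast Nat.factorial_ne_zero _
    simp only [mixtureWeight, chiPDF, e, h1, h2, mul_pow, div_pow, pow_add, pow_mul]
    field_simp
    simp only [← pow_mul]
    ring

lemma marcumKernel_nonneg {m : ℕ} (hm : 1 ≤ m) (a : ℝ) {x : ℝ} (hx : 0 < x) :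
    0 ≤ marcumKernel m a x :=
  (hasSum_marcumKernel hm a x).nonneg fun k =>
    mul_nonneg (mixtureWeight_nonneg a k) (chiPDF_nonneg _ hx)

lemma measurable_marcumKernel {m : ℕ} (hm : 1 ≤ m) (a : ℝ) : Measurable (marcumKernel m a) :=
  measurable_of_tendsto_metrizable (f := fun N x =>
    ∑ k ∈ Finset.range N, mixtureWeight a k * chiPDF (m + k) x)
    (fun _ => Finset.measurable_sum _ fun _ _ => (measurable_chiPDF _).const_mul _)
    (tendsto_pi_nhds.2 fun x => (hasSum_marcumKernel hm a x).tendsto_sum_nat)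

/-- The square of a chi variable with `2j` degrees of freedom has moment generating function
`(1 - 2t)^(-j)`. -/
lemma lintegral_exp_mul_chiPDF {j : ℕ} (hj : 1 ≤ j) {t : ℝ} (ht : t < 1 / 2) :
    ∫⁻ x in Set.Ioi 0, ENNReal.ofReal (Real.exp (t * x ^ 2) * chiPDF j x) =
      ENNReal.ofReal (((1 - 2 * t)⁻¹) ^ j) := by
  obtain ⟨n, rfl⟩ : ∃ n, j = n + 1 := ⟨j - 1, by omega⟩
  have hb : 0 < 1 / 2 - t := by linarith
  have key := integral_rpow_mul_exp_neg_mul_rpow (p := 2) (q := 2 * n + 1) (b := 1 / 2 - t)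
    two_pos (by have : (0:ℝ) ≤ n := n.cast_nonneg
                linarith) hb
  have hG : (2 * (n:ℝ) + 1 + 1) / 2 = n + 1 := by ring
  rw [neg_div, hG, Real.Gamma_nat_eq_factorial] at key
  have hE : ∀ x ∈ Set.Ioi (0:ℝ), Real.exp (t * x ^ 2) * chiPDF (n + 1) x =
      (2 ^ n * (n ! : ℝ))⁻¹ * (x ^ (2 * (n:ℝ) + 1) * Real.exp (-(1 / 2 - t) * x ^ (2:ℝ))) := by
    intro x hx
    have h1 : x ^ (2 * (n:ℝ) + 1) = x ^ (2 * n + 1) := by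
      rw [← Real.rpow_natCast]; push_cast; rfl
    have h2 : -(1 / 2 - t) * x ^ 2 = t * x ^ 2 + -x ^ 2 / 2 := by ring
    rw [h1, Real.rpow_two, h2, Real.exp_add, chiPDF]
    simp only [show 2 * (n + 1) - 1 = 2 * n + 1 by omega, Nat.add_sub_cancel]
    ring
  have hI : ∫ x in Set.Ioi 0, Real.exp (t * x ^ 2) * chiPDF (n + 1) x =
      ((1 - 2 * t)⁻¹) ^ (n + 1) := by
    rw [setIntegral_congr_fun measurableSet_Ioi hE, integral_const_mul, key,
      Real.rpow_neg hb.le, show ((n:ℝ) + 1) = ((n + 1 : ℕ) : ℝ) by push_cast; rfl,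
      Real.rpow_natCast, show 1 - 2 * t = 2 * (1 / 2 - t) by ring, inv_pow, mul_pow]
    have f1 : (n ! : ℝ) ≠ 0 := by exact_mod_cast Nat.factorial_ne_zero _
    field_simp
    ring
  rw [← hI, ofReal_integral_eq_lintegral_ofReal]
  -- a function that is not integrable would have integral `0`
  · by_contra hn
    have := integral_undef hn
    rw [hI] at this
    have h3 : 0 < 1 - 2 * t := by linarith
    exact (pow_pos (inv_pos.2 h3) (n + 1)).ne' this
  · filter_upwards [ae_restrict_mem measurableSet_Ioi] with x hx
    exact mul_nonneg (Real.exp_nonneg _) (chiPDF_nonneg _ hx)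

lemma hasSum_real_exp (x : ℝ) : HasSum (fun k : ℕ => x ^ k / (k ! : ℝ)) (Real.exp x) := by
  rw [Real.exp_eq_exp_ℝ]
  exact NormedSpace.expSeries_div_hasSum_exp x

lemma hasSum_mixtureWeight_mul_pow (m : ℕ) (a r : ℝ) :
    HasSum (fun k => mixtureWeight a k * r ^ (m + k))
      (r ^ m * Real.exp (a ^ 2 / 2 * (r - 1))) := by
  have := (hasSum_real_exp (a ^ 2 / 2 * r)).mul_left (Real.exp (-a ^ 2 / 2) * r ^ m)
  rw [show a ^ 2 / 2 * (r - 1) = -a ^ 2 / 2 + a ^ 2 / 2 * r by ring, Real.exp_add, ← mul_assoc,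
    mul_comm (r ^ m)]
  refine HasSum.congr_fun this fun k => ?_
  simp only [mixtureWeight, mul_pow, pow_add]
  ring

lemma lintegral_exp_mul_marcumKernel {m : ℕ} (hm : 1 ≤ m) (a : ℝ) {t : ℝ} (ht : t < 1 / 2) :
    ∫⁻ x in Set.Ioi 0, ENNReal.ofReal (Real.exp (t * x ^ 2) * marcumKernel m a x) =
      ENNReal.ofReal (((1 - 2 * t)⁻¹) ^ m * Real.exp (a ^ 2 / 2 * ((1 - 2 * t)⁻¹ - 1))) := by
  have hr : 0 ≤ (1 - 2 * t)⁻¹ := inv_nonneg.2 (by linarith)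
  have hS := hasSum_mixtureWeight_mul_pow m a (1 - 2 * t)⁻¹
  calc
    _ = ∫⁻ x in Set.Ioi 0, ∑' k, ENNReal.ofReal (mixtureWeight a k) *
          ENNReal.ofReal (Real.exp (t * x ^ 2) * chiPDF (m + k) x) := by
      refine setLIntegral_congr_fun measurableSet_Ioi fun x hx => ?_
      have h := (hasSum_marcumKernel hm a x).mul_left (Real.exp (t * x ^ 2))
      rw [← h.tsum_eq, ENNReal.ofReal_tsum_of_nonneg _ h.summable]
      · refine tsum_congr fun k => ?_
        rw [← ENNReal.ofReal_mul (mixtureWeight_nonneg a k)]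
        ring_nf
      · exact fun k => mul_nonneg (Real.exp_nonneg _)
          (mul_nonneg (mixtureWeight_nonneg a k) (chiPDF_nonneg _ hx))
    _ = ∑' k, ENNReal.ofReal (mixtureWeight a k) * ENNReal.ofReal (((1 - 2 * t)⁻¹) ^ (m + k)) := by
      have hmeas : ∀ k, Measurable fun x : ℝ =>
          ENNReal.ofReal (Real.exp (t * x ^ 2) * chiPDF (m + k) x) := fun k => by
        have := measurable_chiPDF (m + k)
        fun_prop
      rw [lintegral_tsum fun k => ((hmeas k).const_mul _).aemeasurable]
      refine tsum_congr fun k => ?_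
      rw [lintegral_const_mul _ (hmeas k), lintegral_exp_mul_chiPDF (by omega) ht]
    _ = _ := by
      rw [← hS.tsum_eq, ENNReal.ofReal_tsum_of_nonneg _ hS.summable]
      · exact tsum_congr fun k => (ENNReal.ofReal_mul (mixtureWeight_nonneg a k)).symm
      · exact fun k => mul_nonneg (mixtureWeight_nonneg a k) (pow_nonneg hr _)

/-- The noncentral chi distribution with `2m` degrees of freedom and noncentrality parameter `a`,
that is, the law on `(0, ∞)` with the Marcum kernel as density. -/
def noncentralChi (m : ℕ) (a : ℝ) : Measure ℝ :=
  (volume.restrict (Set.Ioi 0)).withDensity fun x => ENNReal.ofReal (marcumKernel m a x)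

lemma lintegral_exp_noncentralChi {m : ℕ} (hm : 1 ≤ m) (a : ℝ) {t : ℝ} (ht : t < 1 / 2) :
    ∫⁻ x, ENNReal.ofReal (Real.exp (t * x ^ 2)) ∂(noncentralChi m a) =
      ENNReal.ofReal (((1 - 2 * t)⁻¹) ^ m * Real.exp (a ^ 2 / 2 * ((1 - 2 * t)⁻¹ - 1))) := by
  have hmk := measurable_marcumKernel hm a
  rw [noncentralChi, lintegral_withDensity_eq_lintegral_mul _ (by fun_prop) (by fun_prop),
    ← lintegral_exp_mul_marcumKernel hm a ht]
  refine lintegral_congr fun x => ?_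
  rw [Pi.mul_apply, mul_comm, ENNReal.ofReal_mul (Real.exp_nonneg _)]

lemma isProbabilityMeasure_noncentralChi {m : ℕ} (hm : 1 ≤ m) (a : ℝ) :
    IsProbabilityMeasure (noncentralChi m a) :=
  ⟨by simpa using lintegral_exp_noncentralChi hm a (t := 0) (by norm_num)⟩

lemma mgf_sq_noncentralChi {m : ℕ} (hm : 1 ≤ m) (a : ℝ) {t : ℝ} (ht : t < 1 / 2) :
    mgf (fun x => x ^ 2) (noncentralChi m a) t =
      ((1 - 2 * t)⁻¹) ^ m * Real.exp (a ^ 2 / 2 * ((1 - 2 * t)⁻¹ - 1)) := by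
  have hr : 0 ≤ (1 - 2 * t)⁻¹ := inv_nonneg.2 (by linarith)
  rw [mgf, integral_eq_lintegral_of_nonneg_ae (ae_of_all _ fun x => Real.exp_nonneg _)
    (Measurable.aestronglyMeasurable (by fun_prop)), lintegral_exp_noncentralChi hm a ht,
    ENNReal.toReal_ofReal (by positivity)]

/-- The Marcum Q-function is the upper tail of the noncentral chi distribution. -/
lemma marcumQ_eq_measureReal {m : ℕ} (hm : 1 ≤ m) (a : ℝ) {b : ℝ} (hb : 0 ≤ b) :
    marcumQ m a b = (noncentralChi m a).real (Set.Ioi b) := by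
  have hsub : Set.Ioi b ⊆ Set.Ioi 0 := Set.Ioi_subset_Ioi hb
  rw [marcumQ, Measure.real, noncentralChi, withDensity_apply _ measurableSet_Ioi,
    Measure.restrict_restrict measurableSet_Ioi, Set.inter_eq_self_of_subset_left hsub,
    integral_eq_lintegral_of_nonneg_ae]
  · filter_upwards [ae_restrict_mem measurableSet_Ioi] with x hx
    exact marcumKernel_nonneg hm a (hsub hx)
  · exact (measurable_marcumKernel hm a).aestronglyMeasurable

lemma marcumQ_nonneg {m : ℕ} (hm : 1 ≤ m) (a : ℝ) {b : ℝ} (hb : 0 ≤ b) : 0 ≤ marcumQ m a b := by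
  rw [marcumQ_eq_measureReal hm a hb]
  exact measureReal_nonneg

lemma marcumQ_le_one {m : ℕ} (hm : 1 ≤ m) (a : ℝ) {b : ℝ} (hb : 0 ≤ b) : marcumQ m a b ≤ 1 := by
  have := isProbabilityMeasure_noncentralChi hm a
  rw [marcumQ_eq_measureReal hm a hb]
  exact measureReal_le_one

lemma marcumQ_anti {m : ℕ} (hm : 1 ≤ m) (a : ℝ) {b b' : ℝ} (hb : 0 ≤ b) (hbb : b ≤ b') :
    marcumQ m a b' ≤ marcumQ m a b := by
  have := isProbabilityMeasure_noncentralChi hm a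
  rw [marcumQ_eq_measureReal hm a hb, marcumQ_eq_measureReal hm a (hb.trans hbb)]
  exact measureReal_mono (Set.Ioi_subset_Ioi hbb)

/-- For `r < 0` both sides vanish, as `Real.sqrt r = 0`. -/
lemma noncentralChi_real_sq_lt {m : ℕ} (hm : 1 ≤ m) (a r : ℝ) :
    (noncentralChi m a).real {x | x ^ 2 < r} = 1 - marcumQ m a (Real.sqrt r) := by
  have := isProbabilityMeasure_noncentralChi hm a
  have hac : noncentralChi m a ≪ volume :=
    (withDensity_absolutelyContinuous _ _).trans Measure.restrict_le_self.absolutelyContinuous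
  rw [marcumQ_eq_measureReal hm a (Real.sqrt_nonneg r),
    ← probReal_compl_eq_one_sub measurableSet_Ioi]
  -- the law has no atoms, so the boundary point `√r` does not matter
  refine measureReal_congr ?_
  have h0 : ∀ᵐ x ∂(noncentralChi m a), x ∈ Set.Ioi (0:ℝ) :=
    (withDensity_absolutelyContinuous _ _).ae_le (ae_restrict_mem measurableSet_Ioi)
  have h1 : ∀ᵐ x ∂(noncentralChi m a), x ≠ Real.sqrt r := hac.ae_le (Measure.ae_ne volume _)
  filter_upwards [h0, h1] with x hx0 hx1
  refine propext ?_
  change x ^ 2 < r ↔ ¬ (Real.sqrt r < x)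
  rw [not_lt, ← Real.lt_sqrt (le_of_lt hx0)]
  exact ⟨le_of_lt, fun h => lt_of_le_of_ne h hx1⟩

/-! ### Moment generating functions of squared Gaussian variables -/

/-- The moment generating function of the square of a real Gaussian variable. -/
lemma integral_exp_mul_sq_gaussianReal (m : ℝ) {v : ℝ≥0} (hv : v ≠ 0) {s : ℝ}
    (hs : 2 * s * v < 1) :
    ∫ x, Real.exp (s * x ^ 2) ∂(gaussianReal m v) =
      (Real.sqrt (1 - 2 * s * v))⁻¹ * Real.exp (s * m ^ 2 / (1 - 2 * s * v)) := by
  have hd : 0 < 1 - 2 * s * v := by linarith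
  have hv0 : (0 : ℝ) < v := by positivity
  set d : ℝ≥0 := ⟨1 - 2 * s * v, hd.le⟩ with hdef
  have hdc : (d : ℝ) = 1 - 2 * s * v := rfl
  have hd' : d ≠ 0 := fun h => hd.ne' (by rw [← hdc, h]; rfl)
  have hdpos : (0 : ℝ) < d := hd
  rw [integral_gaussianReal_eq_integral_smul hv, ← hdc]
  -- completing the square turns the integrand into a multiple of another Gaussian density
  have key : ∀ x, gaussianPDFReal m v x • Real.exp (s * x ^ 2) =
      ((Real.sqrt d)⁻¹ * Real.exp (s * m ^ 2 / d)) * gaussianPDFReal (m / d) (v / d) x := by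
    intro x
    have hsd : s = (1 - d) / (2 * v) := by rw [hdc]; field_simp; ring
    have e1 : -(x - m) ^ 2 / (2 * v) + s * x ^ 2 =
        s * m ^ 2 / d + -(x - m / d) ^ 2 / (2 * (v / d)) := by
      rw [hsd]
      field_simp
      ring
    have e2 : Real.sqrt (2 * Real.pi * v) =
        Real.sqrt d * Real.sqrt (2 * Real.pi * (v / d)) := by
      rw [← Real.sqrt_mul hdpos.le]
      congr 1
      field_simp
    rw [gaussianPDFReal, gaussianPDFReal, smul_eq_mul, mul_assoc, ← Real.exp_add, e1, Real.exp_add,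
      NNReal.coe_div, e2, mul_inv]
    ring
  simp_rw [key]
  rw [integral_const_mul, integral_gaussianPDFReal_eq_one _ (div_ne_zero hv hd'), mul_one]

/-- The moment generating function of the squared modulus of a complex Gaussian variable. -/
lemma integral_exp_mul_normSq_complexGaussian (c : ℂ) {v : ℝ≥0} (hv : v ≠ 0) {s : ℝ}
    (hs : s * v < 1) :
    ∫ z, Real.exp (s * ‖z‖ ^ 2) ∂(complexGaussian c v) =
      (1 - s * v)⁻¹ * Real.exp (s * ‖c‖ ^ 2 / (1 - s * v)) := by
  have hd : 0 < 1 - s * v := by linarith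
  have hm : Measurable fun z : ℝ × ℝ => (⟨z.1, z.2⟩ : ℂ) :=
    Complex.measurableEquivRealProd.symm.measurable
  have h2 : 2 * s * ((v / 2 : ℝ≥0) : ℝ) = s * v := by push_cast; ring
  have hv2 : v / 2 ≠ 0 := by positivity
  rw [complexGaussian, integral_map hm.aemeasurable
    (Continuous.aestronglyMeasurable (by fun_prop))]
  have e : ∀ z : ℝ × ℝ, Real.exp (s * ‖(⟨z.1, z.2⟩ : ℂ)‖ ^ 2) =
      Real.exp (s * z.1 ^ 2) * Real.exp (s * z.2 ^ 2) := by
    intro z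
    rw [← Real.exp_add, Complex.sq_norm, Complex.normSq_mk]
    ring_nf
  simp_rw [e]
  rw [integral_prod_mul (fun x => Real.exp (s * x ^ 2)) (fun x => Real.exp (s * x ^ 2)),
    integral_exp_mul_sq_gaussianReal _ hv2 (by rw [h2]; exact hs),
    integral_exp_mul_sq_gaussianReal _ hv2 (by rw [h2]; exact hs), h2, Complex.sq_norm,
    Complex.normSq_apply, mul_mul_mul_comm, ← mul_inv, Real.mul_self_sqrt hd.le, ← Real.exp_add]
  ring_nf

lemma mgf_normSq_ricianLaw {κ : ℝ} (hκ : 0 ≤ κ) {t : ℝ} (ht : t < 1 / 2) :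
    mgf (fun z : ℂ => 2 * (1 + κ) * ‖z‖ ^ 2) (ricianLaw κ) t =
      (1 - 2 * t)⁻¹ * Real.exp (κ * ((1 - 2 * t)⁻¹ - 1)) := by
  have hk : 0 < 1 + κ := by linarith
  have hd : 1 - 2 * t ≠ 0 := by intro h; linarith
  have hv : Real.toNNReal (1 / (1 + κ)) ≠ 0 := by
    simpa using hk
  have hvc : ((Real.toNNReal (1 / (1 + κ)) : ℝ≥0) : ℝ) = 1 / (1 + κ) :=
    Real.coe_toNNReal _ (by positivity)
  have hs : t * 2 * (1 + κ) * (Real.toNNReal (1 / (1 + κ)) : ℝ≥0) = 2 * t := by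
    rw [hvc]; field_simp
  rw [mgf, ricianLaw]
  simp_rw [← mul_assoc t]
  rw [integral_exp_mul_normSq_complexGaussian _ hv (by rw [hs]; linarith), hs,
    Complex.norm_real, Real.norm_eq_abs, sq_abs, Real.sq_sqrt (by positivity)]
  have e : (1 - 2 * t)⁻¹ - 1 = 2 * t * (1 - 2 * t)⁻¹ := by
    linear_combination inv_mul_cancel₀ hd
  rw [e]
  congr 2
  field_simp

/-! ### The energy received over a Rician channel -/

section Channel

variable {Ω : Type*} [MeasurableSpace Ω] {μ : Measure Ω} {κ : ℝ} {M : ℕ} {h : ℕ → Fin M → Ω → ℂ}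

/-- The normalized channel energy `2 (1 + κ) ∑ |h b a|²` over the first `n` coherence blocks. The
factor `2 (1 + κ)` gives the real and imaginary parts of the coefficients unit variance. -/
def channelEnergy (κ : ℝ) {M : ℕ} (n : ℕ) (h : ℕ → Fin M → ℂ) : ℝ :=
  ∑ ba ∈ Finset.range n ×ˢ Finset.univ, 2 * (1 + κ) * ‖h ba.1 ba.2‖ ^ 2

lemma mgf_channelEnergy (hκ : 0 ≤ κ) (hh : IsRicianChannel μ κ h) (n : ℕ) {t : ℝ}
    (ht : t < 1 / 2) :
    mgf (fun ω => channelEnergy κ n fun b a => h b a ω) μ t =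
      ((1 - 2 * t)⁻¹) ^ (M * n) * Real.exp ((M * n : ℕ) * κ * ((1 - 2 * t)⁻¹ - 1)) := by
  have hm : Measurable fun z : ℂ => 2 * (1 + κ) * ‖z‖ ^ 2 := by fun_prop
  have hind := hh.indep.comp (fun _ z => 2 * (1 + κ) * ‖z‖ ^ 2) fun _ => hm
  have hae : ∀ ba : ℕ × Fin M, AEMeasurable
      ((fun z : ℂ => 2 * (1 + κ) * ‖z‖ ^ 2) ∘ h ba.1 ba.2) μ := fun ba =>
    hm.comp_aemeasurable (hh.hasLaw ba.1 ba.2).aemeasurable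
  have h1 := hind.mgf_sum₀ (t := t) hae (Finset.range n ×ˢ Finset.univ)
  have h2 : ∀ ba : ℕ × Fin M, mgf ((fun z : ℂ => 2 * (1 + κ) * ‖z‖ ^ 2) ∘ h ba.1 ba.2) μ t =
      (1 - 2 * t)⁻¹ * Real.exp (κ * ((1 - 2 * t)⁻¹ - 1)) := fun ba => by
    rw [← mgf_map (hh.hasLaw ba.1 ba.2).aemeasurable
      (Measurable.aestronglyMeasurable (by fun_prop)), (hh.hasLaw ba.1 ba.2).map_eq,
      mgf_normSq_ricianLaw hκ ht]
  have h3 : (fun ω => channelEnergy κ n fun b a => h b a ω) =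
      ∑ ba ∈ Finset.range n ×ˢ Finset.univ,
        (fun z : ℂ => 2 * (1 + κ) * ‖z‖ ^ 2) ∘ h ba.1 ba.2 := by
    ext ω
    simp [channelEnergy]
  rw [h3, h1, Finset.prod_congr rfl fun ba _ => h2 ba, Finset.prod_const, Finset.card_product,
    Finset.card_range, Finset.card_univ, Fintype.card_fin, mul_comm n M, mul_pow,
    ← Real.exp_nat_mul, mul_assoc ((M * n : ℕ) : ℝ)]

lemma aemeasurable_channelEnergy (hh : IsRicianChannel μ κ h) (n : ℕ) :
    AEMeasurable (fun ω => channelEnergy κ n fun b a => h b a ω) μ := by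
  unfold channelEnergy
  refine Finset.aemeasurable_fun_sum _ fun ba _ => ?_
  have := (hh.hasLaw ba.1 ba.2).aemeasurable
  fun_prop

/-- The normalized channel energy is the square of a noncentral chi variable. -/
lemma map_channelEnergy [IsProbabilityMeasure μ] (hκ : 0 ≤ κ) (hh : IsRicianChannel μ κ h)
    {n : ℕ} (hn : 1 ≤ M * n) :
    μ.map (fun ω => channelEnergy κ n fun b a => h b a ω) =
      (noncentralChi (M * n) (Real.sqrt (2 * M * κ * n))).map fun x => x ^ 2 := by
  have := isProbabilityMeasure_noncentralChi hn (Real.sqrt (2 * M * κ * n))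
  refine map_eq_map_of_mgf_eqOn_Iio (aemeasurable_channelEnergy hh n)
    (Measurable.aemeasurable (by fun_prop)) (c := 1 / 2) (by norm_num) (fun t ht => ?_)
    fun t ht => ?_
  · rw [mgf_channelEnergy hκ hh n ht, mgf_sq_noncentralChi hn _ ht, Real.sq_sqrt (by positivity)]
    push_cast
    ring_nf
  · have : 0 < (1 - 2 * t)⁻¹ := inv_pos.2 (by linarith)
    rw [mgf_channelEnergy hκ hh n ht]
    positivity

lemma measureReal_channelEnergy_lt [IsProbabilityMeasure μ] (hκ : 0 ≤ κ)
    (hh : IsRicianChannel μ κ h) {n : ℕ} (hn : 1 ≤ M * n) (r : ℝ) :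
    μ.real {ω | channelEnergy κ n (fun b a => h b a ω) < r} =
      1 - marcumQ (M * n) (Real.sqrt (2 * M * κ * n)) (Real.sqrt r) := by
  rw [← noncentralChi_real_sq_lt hn]
  have h1 := map_measureReal_apply_of_aemeasurable (aemeasurable_channelEnergy hh n)
    (measurableSet_Iio (a := r))
  rw [map_channelEnergy hκ hh hn, map_measureReal_apply (by fun_prop) measurableSet_Iio] at h1
  exact h1.symm

lemma saHarvested_eq (hκ : 0 ≤ κ) (η P β Tc : ℝ) (n : ℕ) (h : ℕ → Fin M → ℂ) :
    saHarvested η P β Tc n h =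
      η * Tc * (P / M) * β / (2 * (1 + κ)) * channelEnergy κ n h := by
  have hk : 1 + κ ≠ 0 := by positivity
  simp only [saHarvested, saBlockEnergy, incidentPower, channelEnergy, Finset.sum_product,
    Finset.mul_sum, Finset.univ_unique, Finset.sum_singleton, dotProduct_single, mul_one]
  refine Finset.sum_congr rfl fun b _ => Finset.sum_congr rfl fun a _ => ?_
  field_simp

lemma saHarvested_lt_iff (hκ : 0 ≤ κ) {η P β Tc : ℝ} (hη : 0 < η) (hP : 0 < P) (hβ : 0 < β)
    (hTc : 0 < Tc) (hM : 1 ≤ M) (n : ℕ) (h : ℕ → Fin M → ℂ) (E : ℝ) :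
    saHarvested η P β Tc n h < E ↔
      channelEnergy κ n h < 2 * E * (κ + 1) / (η * Tc * (P / M) * β) := by
  have hM0 : (0 : ℝ) < M := by exact_mod_cast hM
  have hk : 0 < 1 + κ := by positivity
  rw [saHarvested_eq hκ, lt_div_iff₀ (by positivity), div_mul_eq_mul_div,
    div_lt_iff₀ (by positivity)]
  constructor <;> intro H <;> linarith

/-- The probability that the energy harvested over `n` blocks falls short of `E`. -/
lemma measureReal_saHarvested_lt [IsProbabilityMeasure μ] (hκ : 0 ≤ κ)
    (hh : IsRicianChannel μ κ h) {η P β Tc : ℝ} (hη : 0 < η) (hP : 0 < P) (hβ : 0 < β)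
    (hTc : 0 < Tc) (hM : 1 ≤ M) {n : ℕ} (hn : 1 ≤ n) (E : ℝ) :
    μ.real {ω | saHarvested η P β Tc n (fun b a => h b a ω) < E} =
      1 - marcumQ (M * n) (Real.sqrt (2 * M * κ * n))
        (Real.sqrt (2 * E * (κ + 1) / (η * Tc * (P / M) * β))) := by
  simp_rw [saHarvested_lt_iff hκ hη hP hβ hTc hM]
  exact measureReal_channelEnergy_lt hκ hh (Nat.mul_pos hM hn) _

end Channel

/-! ### The slotted inter-arrival time -/

lemma expMeasure_real_Iio {r : ℝ} (hr : 0 < r) {x : ℝ} (hx : 0 ≤ x) :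
    (expMeasure r).real (Set.Iio x) = 1 - Real.exp (-(r * x)) := by
  have := isProbabilityMeasure_expMeasure hr
  have hac : expMeasure r ≪ volume := withDensity_absolutelyContinuous _ _
  have h1 : Set.Iio x =ᵐ[expMeasure r] Set.Iic x := hac.ae_le Iio_ae_eq_Iic
  rw [measureReal_congr h1, ← cdf_eq_real, cdf_expMeasure_eq hr, if_pos hx]

/-- The slotted inter-arrival time is geometrically distributed. -/
lemma expMeasure_real_slotted {r : ℝ} (hr : 0 < r) (v : ℕ) :
    (expMeasure r).real {u | slotted u = v + 1} =
      Real.exp (-r * v) - Real.exp (-r * (v + 1 : ℕ)) := by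
  have := isProbabilityMeasure_expMeasure hr
  have hlt : ∀ n : ℕ, {u : ℝ | ⌊u⌋₊ < n + 1} = Set.Iio ((n + 1 : ℕ) : ℝ) := fun n => by
    ext u
    exact Nat.floor_lt' n.succ_ne_zero
  -- `slotted u = 1` also holds for `u < 0`, a null event
  rcases v with _ | v
  · have h0 : {u : ℝ | slotted u = 0 + 1} = Set.Iio ((0 + 1 : ℕ) : ℝ) := by
      rw [← hlt 0]
      ext u
      simp only [slotted, Set.mem_ofPred_eq]
      omega
    rw [h0, expMeasure_real_Iio hr (Nat.cast_nonneg _)]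
    simp
  · have h0 : {u : ℝ | slotted u = v + 1 + 1} =
        Set.Iio ((v + 1 + 1 : ℕ) : ℝ) \ Set.Iio ((v + 1 : ℕ) : ℝ) := by
      rw [← hlt (v + 1), ← hlt v]
      ext u
      simp only [slotted, Set.mem_ofPred_eq, Set.mem_sdiff]
      omega
    rw [h0, measureReal_sdiff (Set.Iio_subset_Iio (by push_cast; linarith)) measurableSet_Iio,
      expMeasure_real_Iio hr (Nat.cast_nonneg _), expMeasure_real_Iio hr (Nat.cast_nonneg _)]
    simp only [neg_mul]
    ring

lemma measurable_slotted : Measurable slotted :=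
  Nat.measurable_floor.add_const 1

/-! ### Outage under Poisson traffic -/

section Outage

variable {Ω : Type*} [MeasurableSpace Ω] {μ : Measure Ω} {κ : ℝ} {M : ℕ} {h : ℕ → Fin M → Ω → ℂ}

/-- The energy outage probability under Poisson traffic, obtained by conditioning on the slotted
inter-arrival time. -/
lemma hasSum_saPoissonOutage [IsProbabilityMeasure μ] (hκ : 0 ≤ κ) (hh : IsRicianChannel μ κ h)
    {η P β Tc : ℝ} (hη : 0 < η) (hP : 0 < P) (hβ : 0 < β) (hTc : 0 < Tc) (hM : 1 ≤ M)
    (ξu pc p t : ℝ) {lam : ℝ} (hlam : 0 < lam) {U : Ω → ℝ} (hU : HasLaw U (expMeasure lam) μ)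
    (hind : IndepFun U (fun ω (ba : ℕ × Fin M) => h ba.1 ba.2 ω) μ) :
    HasSum (fun v : ℕ => (Real.exp (-lam * v) - Real.exp (-lam * (v + 1 : ℕ))) *
        (1 - marcumQ (M * (v + 1)) (Real.sqrt (2 * M * κ * (v + 1 : ℕ)))
          (Real.sqrt (2 * poissonRequirement 0 ξu pc p t Tc (v + 1) * (κ + 1) /
            (η * Tc * (P / M) * β)))))
      (saPoissonOutage μ η P β Tc ξu pc p t h U) := by
  set A : ℕ → Set Ω := fun v => {ω | saHarvested η P β Tc (v + 1) (fun b a => h b a ω) <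
    poissonRequirement 0 ξu pc p t Tc (v + 1)} with hA
  set V : ℕ → Set Ω := fun v => U ⁻¹' {u | slotted u = v + 1} with hV
  have hslot : ∀ v : ℕ, MeasurableSet {u | slotted u = v + 1} := fun v =>
    measurable_slotted (measurableSet_singleton (v + 1))
  have hAm : ∀ v, NullMeasurableSet (A v) μ := fun v => by
    simp only [hA, saHarvested_eq hκ]
    exact nullMeasurableSet_lt ((aemeasurable_channelEnergy hh _).const_mul _) aemeasurable_const
  have hVm : ∀ v, NullMeasurableSet (V v) μ := fun v =>
    hU.aemeasurable.nullMeasurable (hslot v)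
  have hmul : ∀ v, μ.real (V v ∩ A v) = μ.real (V v) * μ.real (A v) := fun v => by
    have hT : MeasurableSet {g : ℕ × Fin M → ℂ | saHarvested η P β Tc (v + 1)
        (fun b a => g (b, a)) < poissonRequirement 0 ξu pc p t Tc (v + 1)} := by
      simp only [saHarvested_eq hκ, channelEnergy]
      refine measurableSet_lt ((Finset.measurable_fun_sum _ fun ba _ => ?_).const_mul _)
        measurable_const
      fun_prop
    have := hind.measure_inter_preimage_eq_mul _ _ (hslot v) hT
    rw [Measure.real, Measure.real, Measure.real, ← ENNReal.toReal_mul]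
    exact congrArg ENNReal.toReal this
  have hdisj : Pairwise (Function.onFun (AEDisjoint μ) fun v => V v ∩ A v) := fun v w hvw =>
    Disjoint.aedisjoint <| Set.disjoint_left.2 fun ω h1 h2 => hvw <| by
      have e1 : slotted (U ω) = v + 1 := h1.1
      have e2 : slotted (U ω) = w + 1 := h2.1
      omega
  have hunion : {ω | saHarvested η P β Tc (slotted (U ω)) (fun b a => h b a ω)
      < poissonRequirement 0 ξu pc p t Tc (slotted (U ω))} = ⋃ v, V v ∩ A v := by
    ext ω
    simp only [Set.mem_iUnion, Set.mem_inter_iff, hV, hA, Set.mem_preimage, Set.mem_ofPred_eq]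
    constructor
    · exact fun H => ⟨⌊U ω⌋₊, rfl, H⟩
    · rintro ⟨v, hv, H⟩
      rwa [hv]
  have hsum := measure_iUnion₀ hdisj fun v => (hVm v).inter (hAm v)
  have hfin : ∑' v, μ (V v ∩ A v) ≠ ∞ := by
    rw [← hsum]
    exact measure_ne_top _ _
  have hS := ENNReal.hasSum_toReal hfin
  rw [← ENNReal.tsum_toReal_eq fun v => measure_ne_top _ _] at hS
  rw [saPoissonOutage, hunion, Measure.real, hsum]
  refine HasSum.congr_fun hS fun v => ?_
  change _ = μ.real (V v ∩ A v)
  rw [hmul, measureReal_saHarvested_lt hκ hh hη hP hβ hTc hM v.succ_pos,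
    ← expMeasure_real_slotted hlam, ← hU.measureReal_eq (hslot v)]
  rfl

end Outage

lemma sum_range_exp_sub (lam : ℝ) (N : ℕ) :
    ∑ v ∈ Finset.range N, (Real.exp (-lam * v) - Real.exp (-lam * (v + 1 : ℕ))) =
      1 - Real.exp (-lam * N) := by
  rw [Finset.sum_range_sub' fun v : ℕ => Real.exp (-lam * v)]
  simp

lemma exp_sub_exp_succ_nonneg {lam : ℝ} (hlam : 0 < lam) (v : ℕ) :
    0 ≤ Real.exp (-lam * v) - Real.exp (-lam * (v + 1 : ℕ)) := by
  rw [sub_nonneg, Real.exp_le_exp]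
  push_cast
  linarith

lemma tendsto_exp_neg_mul_nat {lam : ℝ} (hlam : 0 < lam) :
    Tendsto (fun N : ℕ => Real.exp (-lam * N)) atTop (𝓝 0) := by
  refine Real.tendsto_exp_atBot.comp ?_
  exact tendsto_natCast_atTop_atTop.const_mul_atTop_of_neg (by linarith)

/-- Truncating a mixture of probabilities `1 - q v` with geometric weights, by discarding `q v` for
`v ≥ N`, costs at most the tail of the weights. -/
lemma truncation_bounds {lam : ℝ} (hlam : 0 < lam) {q : ℕ → ℝ} (hq0 : ∀ v, 0 ≤ q v)
    (hq1 : ∀ v, q v ≤ 1) {O : ℝ}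
    (hO : HasSum (fun v : ℕ => (Real.exp (-lam * v) - Real.exp (-lam * (v + 1 : ℕ))) *
      (1 - q v)) O) (N : ℕ) :
    O ≤ 1 - ∑ v ∈ Finset.range N,
        (Real.exp (-lam * v) - Real.exp (-lam * (v + 1 : ℕ))) * q v ∧
    1 - ∑ v ∈ Finset.range N,
        (Real.exp (-lam * v) - Real.exp (-lam * (v + 1 : ℕ))) * q v ≤ O + Real.exp (-lam * N) := by
  have hW : HasSum (fun v : ℕ => Real.exp (-lam * v) - Real.exp (-lam * (v + 1 : ℕ))) 1 := by
    rw [hasSum_iff_tendsto_nat_of_nonneg (exp_sub_exp_succ_nonneg hlam)]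
    simp_rw [sum_range_exp_sub]
    simpa using (tendsto_exp_neg_mul_nat hlam).const_sub 1
  have h1 := sum_le_hasSum (Finset.range N)
    (fun v _ => by
      have := mul_nonneg (exp_sub_exp_succ_nonneg hlam v) (hq0 v)
      linarith) (hW.sub hO)
  have h2 := sum_le_hasSum (Finset.range N)
    (fun v _ => mul_nonneg (exp_sub_exp_succ_nonneg hlam v) (sub_nonneg.2 (hq1 v))) hO
  have h3 := sum_range_exp_sub lam N
  simp only [mul_sub, mul_one, sub_sub_cancel] at h1
  simp only [mul_sub, mul_one, Finset.sum_sub_distrib (f := fun v : ℕ =>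
    Real.exp (-lam * v) - Real.exp (-lam * (v + 1 : ℕ)))] at h2
  constructor <;> linarith

/-- This rests on `1 - e^(-lam) ≤ lam`. -/
lemma ten_le_mul_of_le {lam : ℝ} (hlam : 0 < lam) {x : ℝ}
    (hx : 10 * (Real.exp lam / (Real.exp lam - 1)) ≤ x) : 10 ≤ lam * x := by
  have h1 : 0 < Real.exp lam - 1 := by
    have := Real.add_one_lt_exp hlam.ne'
    linarith
  have h2 : 1 ≤ lam * (Real.exp lam / (Real.exp lam - 1)) := by
    rw [mul_div_assoc', le_div_iff₀ h1]
    have h3 := Real.add_one_le_exp (-lam)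
    rw [Real.exp_neg] at h3
    have h4 := mul_le_mul_of_nonneg_right h3 (Real.exp_pos lam).le
    rw [inv_mul_cancel₀ (Real.exp_pos lam).ne'] at h4
    linarith
  have h5 := mul_le_mul_of_nonneg_left hx hlam.le
  linarith

/-- The truncated mixture expression, with the sum over `1 ≤ v ≤ N` shifted to start at `0` and
the weights `(e^lam - 1) e^(-lam v)` in telescoping form. -/
lemma poissonExpr_eq (Mt : ℕ) {ξu pc p t Tc : ℝ} (η P β κ lam : ℝ) (hκ : 0 ≤ κ)
    (hden : 0 < η * Tc * P * β) (N : ℕ) :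
    poissonExpr Mt 0 η P β Tc κ ξu pc p t lam N =
      1 - ∑ v ∈ Finset.range N, (Real.exp (-lam * v) - Real.exp (-lam * (v + 1 : ℕ))) *
        marcumQ (Mt * (v + 1)) (Real.sqrt (2 * Mt * κ * (v + 1 : ℕ)))
          (Real.sqrt (2 * poissonRequirement 0 ξu pc p t Tc (v + 1) * (κ + 1) /
            (η * Tc * P * β))) := by
  rw [poissonExpr, Finset.mul_sum, ← Finset.Ico_add_one_right_eq_Icc, Finset.sum_Ico_eq_sum_range,
    Nat.add_sub_cancel]
  congr 1
  refine Finset.sum_congr rfl fun v _ => ?_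
  have hr : 2 * poissonRequirement 0 ξu pc p t Tc (v + 1) * (κ + 1) / (η * Tc * P * β) =
      2 * (1 + κ) / (η * Tc * P * β) * ((v + 1 : ℕ) * (0 + pc * Tc) + ξu + p * t) := by
    rw [poissonRequirement]
    ring
  have he : Real.exp (-lam * v) = Real.exp lam * Real.exp (-lam * (v + 1 : ℕ)) := by
    rw [← Real.exp_add]
    push_cast
    ring_nf
  rw [hr, Real.sqrt_mul (x := 2 * (1 + κ) / (η * Tc * P * β)) (by positivity), he,
    poissonTerm, add_comm 1 v]
  ring

lemma poissonRequirement_nonneg {ξu pc p t Tc : ℝ} (hTc : 0 < Tc) (hξu : 0 ≤ ξu) (hpc : 0 ≤ pc)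
    (hp : 0 ≤ p) (ht : 0 ≤ t) (v : ℕ) : 0 ≤ poissonRequirement 0 ξu pc p t Tc v := by
  unfold poissonRequirement
  positivity

/-- The outage probability decreases with the channel gain. -/
lemma one_sub_marcumQ_le {m : ℕ} (hm : 1 ≤ m) (a : ℝ) {c E β β' : ℝ} (hc : 0 < c) (hE : 0 ≤ E)
    (hβ' : 0 < β') (hβ : β' ≤ β) :
    1 - marcumQ m a (Real.sqrt (E / (c * β))) ≤ 1 - marcumQ m a (Real.sqrt (E / (c * β'))) := by
  have := marcumQ_anti hm a (Real.sqrt_nonneg (E / (c * β)))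
    (b' := Real.sqrt (E / (c * β'))) (by gcongr)
  linarith

lemma ciSup_eq_of_forall_le {ι : Type*} {f : ι → ℝ} {j : ι} (hf : ∀ i, f i ≤ f j) :
    ⨆ i, f i = f j := by
  have : Nonempty ι := ⟨j⟩
  exact le_antisymm (ciSup_le hf) (le_ciSup ⟨f j, Set.forall_mem_range.2 hf⟩ j)

end

end SAOutage

open SAOutage in
theorem corollary1 {Ω : Type*} [MeasurableSpace Ω] (μ : Measure Ω) [IsProbabilityMeasure μ]
    {ι : Type*} [Finite ι] (M : ℕ) (hM : 1 ≤ M)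
    (κ η P Tc ξu pc p t : ℝ) (hκ : 0 ≤ κ) (hη : 0 < η) (hη1 : η < 1) (hP : 0 < P) (hTc : 0 < Tc)
    (hξu : 0 ≤ ξu) (hpc : 0 ≤ pc) (hp : 0 ≤ p) (ht : 0 ≤ t)
    (β : ι → ℝ) (hβ : ∀ i, 0 < β i) (i' : ι) (hi' : ∀ i, β i' ≤ β i)
    (h : ι → ℕ → Fin M → Ω → ℂ) (hh : ∀ i, IsRicianChannel μ κ (h i)) :
    -- periodic traffic: exact
    (∀ ts : ℝ, 0 < ts →
      (⨆ i, saPeriodicOutage μ η P (β i) Tc ξu pc p t ts (h i)) =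
          saPeriodicOutage μ η P (β i') Tc ξu pc p t ts (h i') ∧
      saPeriodicOutage μ η P (β i') Tc ξu pc p t ts (h i') =
          periodicExpr M 0 η (P / M) (β i') Tc κ ξu pc p t ts) ∧
    -- Poisson traffic: approximate, with an explicit error, and exact in the limit
    (∀ (lam : ℝ), 0 < lam → ∀ U : ι → Ω → ℝ,
      (∀ i, HasLaw (U i) (expMeasure lam) μ) →
      (∀ i, IndepFun (U i) (fun ω (ba : ℕ × Fin M) => h i ba.1 ba.2 ω) μ) →
      (⨆ i, saPoissonOutage μ η P (β i) Tc ξu pc p t (h i) (U i)) =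
          saPoissonOutage μ η P (β i') Tc ξu pc p t (h i') (U i') ∧
      (∀ vmax : ℕ,
        saPoissonOutage μ η P (β i') Tc ξu pc p t (h i') (U i') ≤
            poissonExpr M 0 η (P / M) (β i') Tc κ ξu pc p t lam vmax ∧
        poissonExpr M 0 η (P / M) (β i') Tc κ ξu pc p t lam vmax ≤
            saPoissonOutage μ η P (β i') Tc ξu pc p t (h i') (U i')
              + Real.exp (-lam * vmax)) ∧
      (∀ vmax : ℕ, 10 * (Real.exp lam / (Real.exp lam - 1)) ≤ vmax →
        |poissonExpr M 0 η (P / M) (β i') Tc κ ξu pc p t lam vmax -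
            saPoissonOutage μ η P (β i') Tc ξu pc p t (h i') (U i')| ≤ Real.exp (-10)) ∧
      Tendsto (fun vmax : ℕ => poissonExpr M 0 η (P / M) (β i') Tc κ ξu pc p t lam vmax) atTop
        (𝓝 (saPoissonOutage μ η P (β i') Tc ξu pc p t (h i') (U i')))) := by
  have hM0 : (0 : ℝ) < M := by exact_mod_cast hM
  have hPM : 0 < P / M := by positivity
  refine ⟨fun ts hts => ?_, fun lam hlam U hU hind => ?_⟩
  · have hn : 1 ≤ periodBlocks ts Tc := Nat.one_le_ceil_iff.2 (by positivity)
    have hE : 0 ≤ 2 * periodicRequirement 0 ξu pc p t ts Tc * (κ + 1) := by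
      unfold periodicRequirement
      positivity
    have key : ∀ i, saPeriodicOutage μ η P (β i) Tc ξu pc p t ts (h i) =
        periodicExpr M 0 η (P / M) (β i) Tc κ ξu pc p t ts := fun i =>
      measureReal_saHarvested_lt hκ (hh i) hη hP (hβ i) hTc hM hn _
    refine ⟨ciSup_eq_of_forall_le fun i => ?_, key i'⟩
    rw [key, key]
    exact one_sub_marcumQ_le (Nat.mul_pos hM hn) _ (by positivity) hE (hβ i') (hi' i)
  · have key := fun i => hasSum_saPoissonOutage hκ (hh i) hη hP (hβ i) hTc hM ξu pc p t hlam
      (hU i) (hind i)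
    have hbd : ∀ vmax : ℕ, _ := fun vmax => truncation_bounds hlam
      (fun v => marcumQ_nonneg (Nat.mul_pos hM v.succ_pos) _ (Real.sqrt_nonneg _))
      (fun v => marcumQ_le_one (Nat.mul_pos hM v.succ_pos) _ (Real.sqrt_nonneg _)) (key i') vmax
    simp_rw [← poissonExpr_eq M (ξu := ξu) (pc := pc) (p := p) (t := t) η (P / M) (β i') κ lam hκ
      (mul_pos (mul_pos (mul_pos hη hTc) hPM) (hβ i'))] at hbd
    refine ⟨ciSup_eq_of_forall_le fun i => ?_, hbd, fun vmax hv => ?_, ?_⟩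
    · refine hasSum_le (fun v => ?_) (key i) (key i')
      refine mul_le_mul_of_nonneg_left ?_ (exp_sub_exp_succ_nonneg hlam v)
      have hE := poissonRequirement_nonneg hTc hξu hpc hp ht (v + 1)
      exact one_sub_marcumQ_le (Nat.mul_pos hM v.succ_pos) _ (by positivity) (by positivity)
        (hβ i') (hi' i)
    · rw [abs_of_nonneg (sub_nonneg.2 (hbd vmax).1), sub_le_iff_le_add']
      refine (hbd vmax).2.trans (add_le_add_right (Real.exp_le_exp.2 ?_) _)
      have := ten_le_mul_of_le hlam hv
      linarith
    · refine tendsto_of_tendsto_of_tendsto_of_le_of_le tendsto_const_nhds ?_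
        (fun v => (hbd v).1) (fun v => (hbd v).2)
      simpa using (tendsto_exp_neg_mul_nat hlam).const_add
        (saPoissonOutage μ η P (β i') Tc ξu pc p t (h i') (U i'))
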